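/- Let $k$ be a field and let $A=\bigoplus_{n\ge 0}A(n)$ be a graded Hopf algebra over $k$ with bijective antipode. Let $M$ be a graded (left-left) Yetter-Drinfel'd module over $A$, that is, a Yetter-Drinfel'd module with a vector space grading $M=\bigoplus_{n\ge 1}M(n)$ such that the action $A\otimes M\to M$ and the coaction $M\to A\otimes M$ are graded maps, where $(A\otimes M)(n)=\sum_{i+j=n}A(i)\otimes M(j)$. Let $\mathfrak{B}(M)$ be the Nichols algebra of $M$: a braided Hopf algebra in ${}^A_A\mathcal{YD}$ which has a grading $\mathfrak{B}(M)=\bigoplus_{n\ge0}R(n)$ as an algebra and as a coalgebra such that $c(R(i)\otimes R(j))\subset R(j)\otimes R(i)$ for the braiding $c(x\otimes y)=x_{(-1)}y\otimes x_{(0)}$, such that $R(1)\cong M$ as Yetter-Drinfel'd modules (in particular as braided vector spaces), $\mathfrak{B}(M)$ is generated by $R(1)$ as an algebra, and $R(1)$ is the space of primitive elements $\{x:\Delta(x)=x\otimes 1+1\otimes x\}$. Identify $M$ with $R(1)\subset\mathfrak{B}(M)$. Then there is a grading \[ \mathfrak{B}(M)=\bigoplus_{n\ge 0}\mathfrak{B}(M)[n]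 \] for which the action and the coaction of $A$ on $\mathfrak{B}(M)$ are graded maps (so that $\mathfrak{B}(M)$ is a graded Yetter-Drinfel'd module over $A$, with degrees $n\ge 0$) and for which $\mathfrak{B}(M)$ is a graded braided Hopf algebra (multiplication, unit, comultiplication, counit and antipode are graded maps), such that \[ \mathfrak{B}(M)[0]=k1 \quad\text{and}\quad \mathfrak{B}(M)[1]=M(1). \] -/

import Mathlib

open scoped TensorProduct

namespace Nichols

noncomputable section

/-! ### Yetter-Drinfeld modules -/

section YetterDrinfeld

variable (k A M : Type*) [Field k] [Ring A] [HopfAlgebra k A]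
  [AddCommGroup M] [Module k M] [Module A M] [IsScalarTower k A M]

/-- The action of an algebra on a module as a linear map `a ⊗ m ↦ a • m`. -/
def act : A ⊗[k] M →ₗ[k] M :=
  TensorProduct.lift (Algebra.lsmul k k M : A →ₐ[k] Module.End k M).toLinearMap

@[simp] theorem act_tmul (a : A) (m : M) : act k A M (a ⊗ₜ m) = a • m := rfl

/-- The linear map `a ⊗ (b ⊗ c) ↦ (x ⊗ m ↦ a x S(c) ⊗ b m)`. -/
def ydTwist : A ⊗[k] (A ⊗[k] A) →ₗ[k] (A ⊗[k] M →ₗ[k] A ⊗[k] M) :=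
  TensorProduct.homTensorHomMap (RingHom.id k) A M A M ∘ₗ
    (TensorProduct.comm k (Module.End k M) (Module.End k A)).toLinearMap ∘ₗ
    TensorProduct.map (Algebra.lsmul k k M : A →ₐ[k] Module.End k M).toLinearMap
      (TensorProduct.lift
        ((LinearMap.mul k (Module.End k A)).compl₁₂ (LinearMap.mul k A)
          ((LinearMap.mul k A).flip ∘ₗ HopfAlgebra.antipode k))) ∘ₗ
    (TensorProduct.leftComm k A A A).toLinearMap

@[simp] theorem ydTwist_tmul (a b c x : A) (m : M) :
    ydTwist k A M (a ⊗ₜ (b ⊗ₜ c)) (x ⊗ₜ m) =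
      (a * (x * HopfAlgebra.antipode k c)) ⊗ₜ (b • m) := rfl

end YetterDrinfeld

/-- A left-left Yetter-Drinfeld module over the Hopf algebra `A`: a left `A`-module with a left
`A`-coaction `δ` (written `δ m = m₍₋₁₎ ⊗ m₍₀₎`) such that
`δ (a m) = a₍₁₎ m₍₋₁₎ S(a₍₃₎) ⊗ a₍₂₎ m₍₀₎`. -/
class YetterDrinfeldModule (k A M : Type*) [Field k] [Ring A] [HopfAlgebra k A]
    [AddCommGroup M] [Module k M] [Module A M] [IsScalarTower k A M] where
  /-- The coaction. -/
  coact : M →ₗ[k] A ⊗[k] M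
  coact_coassoc :
    (TensorProduct.assoc k A A M).toLinearMap ∘ₗ
        (Coalgebra.comul (R := k) (A := A)).rTensor M ∘ₗ coact =
      coact.lTensor A ∘ₗ coact
  coact_counit :
    (TensorProduct.lid k M).toLinearMap ∘ₗ
        (Coalgebra.counit (R := k) (A := A)).rTensor M ∘ₗ coact =
      LinearMap.id
  coact_smul : ∀ (a : A) (m : M),
    coact (a • m) =
      ydTwist k A M ((Coalgebra.comul (R := k) (A := A)).lTensor A (Coalgebra.comul a)) (coact m)


open YetterDrinfeldModule (coact)

section Tensor

variable (k A M N : Type*) [Field k] [Ring A] [HopfAlgebra k A]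
  [AddCommGroup M] [Module k M] [Module A M] [IsScalarTower k A M]
  [AddCommGroup N] [Module k N] [Module A N] [IsScalarTower k A N]

/-- The diagonal action of `A` on `M ⊗ N`: `a (m ⊗ n) = a₍₁₎ m ⊗ a₍₂₎ n`. -/
def tensorAct : A →ₗ[k] (M ⊗[k] N →ₗ[k] M ⊗[k] N) :=
  TensorProduct.homTensorHomMap (RingHom.id k) M N M N ∘ₗ
    TensorProduct.map (Algebra.lsmul k k M : A →ₐ[k] Module.End k M).toLinearMap
      (Algebra.lsmul k k N : A →ₐ[k] Module.End k N).toLinearMap ∘ₗ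
    Coalgebra.comul

variable [YetterDrinfeldModule k A M]

/-- The braiding `M ⊗ N → N ⊗ M`, `m ⊗ n ↦ m₍₋₁₎ n ⊗ m₍₀₎`. -/
def braiding : M ⊗[k] N →ₗ[k] N ⊗[k] M :=
  (act k A N).rTensor M ∘ₗ (TensorProduct.rightComm k A M N).toLinearMap ∘ₗ
    (coact (k := k) (A := A) (M := M)).rTensor N

variable [YetterDrinfeldModule k A N]

/-- The codiagonal coaction on `M ⊗ N`: `m ⊗ n ↦ m₍₋₁₎ n₍₋₁₎ ⊗ (m₍₀₎ ⊗ n₍₀₎)`. -/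
def tensorCoact : M ⊗[k] N →ₗ[k] A ⊗[k] (M ⊗[k] N) :=
  (LinearMap.mul' k A).rTensor (M ⊗[k] N) ∘ₗ
    (TensorProduct.tensorTensorTensorComm k A M A N).toLinearMap ∘ₗ
    TensorProduct.map coact coact

end Tensor

/-! ### Braided Hopf algebras -/

/-- The multiplication `(m ⊗ m) (id ⊗ c ⊗ id)` of the braided tensor product `R ⊗ R`, where `m` is
the multiplication and `c` the braiding of `R`. -/
def braidedMul (k A R : Type*) [Field k] [Ring A] [HopfAlgebra k A] [Ring R] [Algebra k R]
    [Module A R] [IsScalarTower k A R] [YetterDrinfeldModule k A R] :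
    (R ⊗[k] R) ⊗[k] (R ⊗[k] R) →ₗ[k] R ⊗[k] R :=
  TensorProduct.map (LinearMap.mul' k R) (LinearMap.mul' k R) ∘ₗ
    (TensorProduct.assoc k R R (R ⊗[k] R)).symm.toLinearMap ∘ₗ
    ((TensorProduct.assoc k R R R).toLinearMap ∘ₗ
      (braiding k A R R).rTensor R ∘ₗ
      (TensorProduct.assoc k R R R).symm.toLinearMap).lTensor R ∘ₗ
    (TensorProduct.assoc k R R (R ⊗[k] R)).toLinearMap

/-- A braided Hopf algebra in the category of Yetter-Drinfeld modules over `A`: an algebra and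
coalgebra `R` whose structure maps are `A`-linear and `A`-colinear, whose comultiplication
`R → R ⊗ R` (braided tensor product) and counit are algebra morphisms, and whose identity map is
convolution invertible. -/
class BraidedHopfAlgebra (k A R : Type*) [Field k] [Ring A] [HopfAlgebra k A]
    [Ring R] [Algebra k R] [Coalgebra k R] [Module A R] [IsScalarTower k A R]
    [YetterDrinfeldModule k A R] where
  smul_mul : ∀ (a : A) (x y : R),
    a • (x * y) = LinearMap.mul' k R (tensorAct k A R R a (x ⊗ₜ y))
  smul_one : ∀ a : A, a • (1 : R) = algebraMap k R (Coalgebra.counit a)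
  comul_smul : ∀ (a : A) (x : R),
    Coalgebra.comul (R := k) (a • x) = tensorAct k A R R a (Coalgebra.comul x)
  counit_smul : ∀ (a : A) (x : R),
    Coalgebra.counit (R := k) (a • x) = Coalgebra.counit (R := k) a * Coalgebra.counit (R := k) x
  coact_mul : ∀ x y : R,
    coact (k := k) (A := A) (x * y) =
      (LinearMap.mul' k R).lTensor A (tensorCoact k A R R (x ⊗ₜ y))
  coact_one : coact (k := k) (A := A) (1 : R) = 1 ⊗ₜ 1
  coact_comul : ∀ x : R,
    tensorCoact k A R R (Coalgebra.comul x) =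
      (Coalgebra.comul (R := k) (A := R)).lTensor A (coact x)
  coact_counit : ∀ x : R,
    (Coalgebra.counit (R := k) (A := R)).lTensor A (coact x) =
      (1 : A) ⊗ₜ[k] Coalgebra.counit (R := k) x
  comul_mul : ∀ x y : R,
    Coalgebra.comul (R := k) (x * y) =
      braidedMul k A R (Coalgebra.comul x ⊗ₜ Coalgebra.comul y)
  comul_one : Coalgebra.comul (R := k) (1 : R) = 1 ⊗ₜ 1
  counit_mul : ∀ x y : R,
    Coalgebra.counit (R := k) (x * y) = Coalgebra.counit (R := k) x * Coalgebra.counit (R := k) y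
  counit_one : Coalgebra.counit (R := k) (1 : R) = 1
  /-- The antipode, i.e. the convolution inverse of the identity. -/
  antipode : R →ₗ[k] R
  antipode_left :
    LinearMap.mul' k R ∘ₗ antipode.rTensor R ∘ₗ Coalgebra.comul =
      Algebra.linearMap k R ∘ₗ Coalgebra.counit
  antipode_right :
    LinearMap.mul' k R ∘ₗ antipode.lTensor R ∘ₗ Coalgebra.comul =
      Algebra.linearMap k R ∘ₗ Coalgebra.counit

/-! ### Gradings -/

/-- The image of `U ⊗ V` in `M ⊗ N`. -/
def tensorSub {k M N : Type*} [Field k] [AddCommGroup M] [Module k M] [AddCommGroup N] [Module k N]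
    (U : Submodule k M) (V : Submodule k N) : Submodule k (M ⊗[k] N) :=
  LinearMap.range (TensorProduct.mapIncl U V)

/-- The usual grading of a tensor product: `(M ⊗ N)(n) = ∑_{i + j = n} M(i) ⊗ N(j)`. -/
def tensorGrading {k M N : Type*} [Field k] [AddCommGroup M] [Module k M] [AddCommGroup N]
    [Module k N] (ℳ : ℕ → Submodule k M) (𝒩 : ℕ → Submodule k N) (n : ℕ) :
    Submodule k (M ⊗[k] N) :=
  ⨆ (i : ℕ) (j : ℕ) (_ : i + j = n), tensorSub (ℳ i) (𝒩 j)

/-- `R = ⨁ R(n)` is a grading of `R` both as an algebra and as a coalgebra. -/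
structure IsAlgCoalgGrading {k R : Type*} [Field k] [Ring R] [Algebra k R] [Coalgebra k R]
    (ℛ : ℕ → Submodule k R) : Prop where
  isInternal : DirectSum.IsInternal ℛ
  one_mem : (1 : R) ∈ ℛ 0
  mul_mem : ∀ {i j : ℕ} {x y : R}, x ∈ ℛ i → y ∈ ℛ j → x * y ∈ ℛ (i + j)
  comul_mem : ∀ {n : ℕ} {x : R}, x ∈ ℛ n → Coalgebra.comul (R := k) x ∈ tensorGrading ℛ ℛ n
  counit_eq_zero : ∀ {n : ℕ} {x : R}, n ≠ 0 → x ∈ ℛ n → Coalgebra.counit (R := k) x = 0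

/-- `A = ⨁ A(n)` is a graded Hopf algebra. -/
structure IsHopfGrading {k A : Type*} [Field k] [Ring A] [HopfAlgebra k A]
    (𝒜 : ℕ → Submodule k A) : Prop extends IsAlgCoalgGrading 𝒜 where
  antipode_mem : ∀ {n : ℕ} {a : A}, a ∈ 𝒜 n → HopfAlgebra.antipode k a ∈ 𝒜 n

/-- `M = ⨁ M(n)` is a vector space grading of the Yetter-Drinfeld module `M` over the graded Hopf
algebra `A` for which the action and the coaction are graded maps. -/
structure IsYDGrading {k A M : Type*} [Field k] [Ring A] [HopfAlgebra k A]
    [AddCommGroup M] [Module k M] [Module A M] [IsScalarTower k A M] [YetterDrinfeldModule k A M]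
    (𝒜 : ℕ → Submodule k A) (ℳ : ℕ → Submodule k M) : Prop where
  isInternal : DirectSum.IsInternal ℳ
  smul_mem : ∀ {i j : ℕ} {a : A} {m : M}, a ∈ 𝒜 i → m ∈ ℳ j → a • m ∈ ℳ (i + j)
  coact_mem : ∀ {n : ℕ} {m : M}, m ∈ ℳ n → coact (k := k) (A := A) m ∈ tensorGrading 𝒜 ℳ n

/-- `R = ⨁ R(n)` is a graded braided Hopf algebra. -/
structure IsBraidedHopfGrading {k : Type*} (A : Type*) {R : Type*} [Field k] [Ring A]
    [HopfAlgebra k A] [Ring R] [Algebra k R] [Coalgebra k R] [Module A R] [IsScalarTower k A R]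
    [YetterDrinfeldModule k A R] [BraidedHopfAlgebra k A R]
    (ℛ : ℕ → Submodule k R) : Prop extends IsAlgCoalgGrading ℛ where
  antipode_mem : ∀ {n : ℕ} {x : R}, x ∈ ℛ n →
    BraidedHopfAlgebra.antipode (k := k) (A := A) x ∈ ℛ n

/-! ### Nichols algebras -/

/-- The braided Hopf algebra `B`, together with the map `ι : M → B`, is a Nichols algebra of the
Yetter-Drinfeld module `M`: there is a grading `B = ⨁ R(n)` as an algebra and coalgebra,
compatible with the braiding, such that `ι` is an isomorphism of Yetter-Drinfeld modules from `M`
onto `R(1)`, the algebra `B` is generated by `R(1)`, and `R(1)` is the space of primitive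
elements. -/
structure IsNicholsAlgebra {k : Type*} (A : Type*) {M B : Type*} [Field k] [Ring A]
    [HopfAlgebra k A]
    [AddCommGroup M] [Module k M] [Module A M] [IsScalarTower k A M] [YetterDrinfeldModule k A M]
    [Ring B] [Algebra k B] [Coalgebra k B] [Module A B] [IsScalarTower k A B]
    [YetterDrinfeldModule k A B] [BraidedHopfAlgebra k A B] (ι : M →ₗ[k] B) : Prop where
  ι_injective : Function.Injective ι
  ι_smul : ∀ (a : A) (m : M), ι (a • m) = a • ι m
  ι_coact : ∀ m : M, coact (k := k) (A := A) (ι m) = ι.lTensor A (coact m)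
  exists_grading : ∃ ℛ : ℕ → Submodule k B,
    IsAlgCoalgGrading ℛ ∧
    (∀ i j : ℕ, (tensorSub (ℛ i) (ℛ j)).map (braiding k A B B) ≤ tensorSub (ℛ j) (ℛ i)) ∧
    LinearMap.range ι = ℛ 1 ∧
    Algebra.adjoin k (ℛ 1 : Set B) = ⊤ ∧
    ∀ x : B, x ∈ ℛ 1 ↔ Coalgebra.comul (R := k) x = x ⊗ₜ 1 + 1 ⊗ₜ x

end

end Nichols

/-! The grading is the smallest family `ℬ` of subspaces of `𝔅(M)` which is closed under
multiplication, has `1` in degree `0`, and contains `M(n)` in degree `n`. Its members span `𝔅(M)`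
because `M` generates this algebra, and since `M(0) = 0` the degrees `0` and `1` are `k1` and
`M(1)`. Action, coaction and comultiplication are multiplicative, so the elements on which one of
them is graded form a family closed under multiplication; by minimality they contain `ℬ` as soon as
they contain `M`. The antipode is graded because it is determined recursively by the convolution
equation.

What has to be shown is that the sum of the `ℬ(n)` is direct. As `ℬ` is connected, the reduced
comultiplication maps `ℬ(n)` into the sum of the `ℬ(i) ⊗ ℬ(j)` with `i + j = n` and `i, j < n`. By
induction the sums in lower degrees, hence those in the tensor square, are direct. Therefore an
element of `ℬ(n)` which is also a sum of elements of other degrees is annihilated by the counit and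
by the reduced comultiplication, i.e. it is primitive and thus lies in `M`. Finally the projection
`φ : 𝔅(M) → R(1) = M` satisfies `φ(xy) = ε(x) φ(y) + ε(y) φ(x)`, so that it maps `ℬ(n)` to `M(n)`,
and the element vanishes since the sum of the `M(n)` is direct. -/

namespace Nichols

open YetterDrinfeldModule (coact)

noncomputable section

section GradedMaps

variable {k M N P M' N' P' : Type*} [Field k] [AddCommGroup M] [Module k M] [AddCommGroup N]
  [Module k N] [AddCommGroup P] [Module k P] [AddCommGroup M'] [Module k M'] [AddCommGroup N']
  [Module k N'] [AddCommGroup P'] [Module k P']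

theorem tmul_mem_tensorGrading {𝒰 : ℕ → Submodule k M} {𝒱 : ℕ → Submodule k N} {i j n : ℕ}
    (hn : i + j = n) {x : M} {y : N} (hx : x ∈ 𝒰 i) (hy : y ∈ 𝒱 j) :
    x ⊗ₜ[k] y ∈ tensorGrading 𝒰 𝒱 n :=
  Submodule.mem_iSup_of_mem i <| Submodule.mem_iSup_of_mem j <|
    Submodule.mem_iSup_of_mem hn ⟨⟨x, hx⟩ ⊗ₜ ⟨y, hy⟩, rfl⟩

theorem map_mem_of_mem_tensorGrading {𝒰 : ℕ → Submodule k M} {𝒱 : ℕ → Submodule k N} {n : ℕ}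
    {W : Submodule k P} (f : M ⊗[k] N →ₗ[k] P)
    (h : ∀ i j, i + j = n → ∀ x ∈ 𝒰 i, ∀ y ∈ 𝒱 j, f (x ⊗ₜ[k] y) ∈ W)
    {t : M ⊗[k] N} (ht : t ∈ tensorGrading 𝒰 𝒱 n) : f t ∈ W := by
  suffices tensorGrading 𝒰 𝒱 n ≤ W.comap f from this ht
  refine iSup_le fun i => iSup_le fun j => iSup_le fun hij => ?_
  rintro _ ⟨s, rfl⟩
  induction s with
  | zero => simp
  | tmul x y => exact h i j hij x x.2 y y.2
  | add s t hs ht => simpa using add_mem hs ht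

/-- A linear map which preserves degrees. The families of submodules need not be gradings. -/
def IsGradedMap (𝒰 : ℕ → Submodule k M) (𝒱 : ℕ → Submodule k N) (f : M →ₗ[k] N) : Prop :=
  ∀ ⦃n : ℕ⦄ ⦃x : M⦄, x ∈ 𝒰 n → f x ∈ 𝒱 n

namespace IsGradedMap

variable {𝒰 : ℕ → Submodule k M} {𝒱 : ℕ → Submodule k N} {𝒲 : ℕ → Submodule k P}
  {𝒰' : ℕ → Submodule k M'} {𝒱' : ℕ → Submodule k N'} {𝒲' : ℕ → Submodule k P'}

theorem id : IsGradedMap 𝒰 𝒰 (LinearMap.id (R := k)) := fun _ _ hx => hx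

theorem comp {g : N →ₗ[k] P} {f : M →ₗ[k] N} (hg : IsGradedMap 𝒱 𝒲 g)
    (hf : IsGradedMap 𝒰 𝒱 f) : IsGradedMap 𝒰 𝒲 (g ∘ₗ f) :=
  fun _ _ hx => hg (hf hx)

theorem of_tmul {f : M ⊗[k] N →ₗ[k] P}
    (h : ∀ ⦃i x⦄, x ∈ 𝒰 i → ∀ ⦃j y⦄, y ∈ 𝒱 j → f (x ⊗ₜ y) ∈ 𝒲 (i + j)) :
    IsGradedMap (tensorGrading 𝒰 𝒱) 𝒲 f :=
  fun _ _ => map_mem_of_mem_tensorGrading f fun _ _ hij _ hx _ hy => hij ▸ h hx hy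

theorem map {f : M →ₗ[k] M'} {g : N →ₗ[k] N'} (hf : IsGradedMap 𝒰 𝒰' f)
    (hg : IsGradedMap 𝒱 𝒱' g) :
    IsGradedMap (tensorGrading 𝒰 𝒱) (tensorGrading 𝒰' 𝒱') (TensorProduct.map f g) :=
  of_tmul fun _ _ hx _ _ hy => tmul_mem_tensorGrading rfl (hf hx) (hg hy)

theorem of_tmul_tmul_left {f : (M ⊗[k] N) ⊗[k] P →ₗ[k] P'}
    (h : ∀ ⦃i x⦄, x ∈ 𝒰 i → ∀ ⦃j y⦄, y ∈ 𝒱 j → ∀ ⦃l z⦄, z ∈ 𝒲 l →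
      f ((x ⊗ₜ y) ⊗ₜ z) ∈ 𝒲' (i + j + l)) :
    IsGradedMap (tensorGrading (tensorGrading 𝒰 𝒱) 𝒲) 𝒲' f :=
  of_tmul fun _ _ ht _ z hz =>
    map_mem_of_mem_tensorGrading (f ∘ₗ (TensorProduct.mk k (M ⊗[k] N) P).flip z)
      (fun _ _ hij _ hx _ hy => hij ▸ h hx hy hz) ht

theorem of_tmul_tmul_right {f : M ⊗[k] (N ⊗[k] P) →ₗ[k] P'}
    (h : ∀ ⦃i x⦄, x ∈ 𝒰 i → ∀ ⦃j y⦄, y ∈ 𝒱 j → ∀ ⦃l z⦄, z ∈ 𝒲 l →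
      f (x ⊗ₜ (y ⊗ₜ z)) ∈ 𝒲' (i + (j + l))) :
    IsGradedMap (tensorGrading 𝒰 (tensorGrading 𝒱 𝒲)) 𝒲' f :=
  of_tmul fun _ x hx _ _ ht =>
    map_mem_of_mem_tensorGrading (f ∘ₗ TensorProduct.mk k M (N ⊗[k] P) x)
      (fun _ _ hij _ hy _ hz => hij ▸ h hx hy hz) ht

theorem assoc : IsGradedMap (tensorGrading (tensorGrading 𝒰 𝒱) 𝒲)
    (tensorGrading 𝒰 (tensorGrading 𝒱 𝒲)) (TensorProduct.assoc k M N P).toLinearMap :=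
  of_tmul_tmul_left fun _ _ hx _ _ hy _ _ hz =>
    tmul_mem_tensorGrading (add_assoc ..).symm hx (tmul_mem_tensorGrading rfl hy hz)

theorem assoc_symm : IsGradedMap (tensorGrading 𝒰 (tensorGrading 𝒱 𝒲))
    (tensorGrading (tensorGrading 𝒰 𝒱) 𝒲) (TensorProduct.assoc k M N P).symm.toLinearMap :=
  of_tmul_tmul_right fun _ _ hx _ _ hy _ _ hz =>
    tmul_mem_tensorGrading (add_assoc ..) (tmul_mem_tensorGrading rfl hx hy) hz

theorem rightComm : IsGradedMap (tensorGrading (tensorGrading 𝒰 𝒱) 𝒲)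
    (tensorGrading (tensorGrading 𝒰 𝒲) 𝒱) (TensorProduct.rightComm k M N P).toLinearMap :=
  of_tmul_tmul_left fun _ _ hx _ _ hy _ _ hz =>
    tmul_mem_tensorGrading (add_right_comm ..) (tmul_mem_tensorGrading rfl hx hz) hy

theorem tensorTensorTensorComm :
    IsGradedMap (tensorGrading (tensorGrading 𝒰 𝒱) (tensorGrading 𝒲 𝒲'))
      (tensorGrading (tensorGrading 𝒰 𝒲) (tensorGrading 𝒱 𝒲'))
      (TensorProduct.tensorTensorTensorComm k M N P P').toLinearMap :=
  of_tmul_tmul_left fun _ x hx _ y hy _ _ ht =>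
    map_mem_of_mem_tensorGrading ((TensorProduct.tensorTensorTensorComm k M N P P').toLinearMap ∘ₗ
        TensorProduct.mk k (M ⊗[k] N) (P ⊗[k] P') (x ⊗ₜ y))
      (fun _ _ hij _ hz _ hw => tmul_mem_tensorGrading (hij ▸ add_add_add_comm ..)
        (tmul_mem_tensorGrading rfl hx hz) (tmul_mem_tensorGrading rfl hy hw)) ht

theorem mul' {B : Type*} [Ring B] [Algebra k B] {𝒢 : ℕ → Submodule k B}
    [SetLike.GradedMonoid 𝒢] : IsGradedMap (tensorGrading 𝒢 𝒢) 𝒢 (LinearMap.mul' k B) :=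
  of_tmul fun _ _ hx _ _ hy => SetLike.GradedMul.mul_mem hx hy

end IsGradedMap

end GradedMaps

section Independence

variable {k M N : Type*} [Field k] [AddCommGroup M] [Module k M] [AddCommGroup N] [Module k N]

theorem iSupIndep_iff_exists_projection {σ : Type*} {U : σ → Submodule k M} :
    iSupIndep U ↔ ∀ n, ∃ p : M →ₗ[k] M,
      (∀ x ∈ U n, p x = x) ∧ ∀ m, m ≠ n → ∀ x ∈ U m, p x = 0 := by
  refine ⟨fun h n => ?_, fun h n => Submodule.disjoint_def.2 fun x hx hx' => ?_⟩
  · obtain ⟨W, hW, hc⟩ := (h n).symm.exists_isCompl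
    refine ⟨(U n).projection W hc.symm, fun x hx => ?_, fun m hm x hx => ?_⟩
    · exact Submodule.projection_apply_of_mem_left hc.symm hx
    · exact (Submodule.projection_apply_eq_zero_iff hc.symm).2
        (hW (Submodule.mem_iSup_of_mem m (Submodule.mem_iSup_of_mem hm hx)))
  · obtain ⟨p, hpn, hpm⟩ := h n
    rw [← hpn x hx]
    have : ⨆ m, ⨆ _ : m ≠ n, U m ≤ LinearMap.ker p := iSup₂_le hpm
    exact this hx'

theorem iSupIndep_tensorGrading {𝒰 : ℕ → Submodule k M} {𝒱 : ℕ → Submodule k N}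
    (h𝒰 : iSupIndep 𝒰) (h𝒱 : iSupIndep 𝒱) : iSupIndep (tensorGrading 𝒰 𝒱) := by
  choose p hp hp0 using iSupIndep_iff_exists_projection.1 h𝒰
  choose q hq hq0 using iSupIndep_iff_exists_projection.1 h𝒱
  let T (n : ℕ) := ∑ r ∈ Finset.HasAntidiagonal.antidiagonal n, TensorProduct.map (p r.1) (q r.2)
  have hpq {i j : ℕ} {x : M} {y : N} (hx : x ∈ 𝒰 i) (hy : y ∈ 𝒱 j) {r : ℕ × ℕ}
      (hr : r ≠ (i, j)) : TensorProduct.map (p r.1) (q r.2) (x ⊗ₜ y) = 0 := by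
    rw [TensorProduct.map_tmul]
    rcases eq_or_ne r.1 i with hi | hi
    · have hj : r.2 ≠ j := fun hj => hr (Prod.ext hi hj)
      rw [hq0 _ _ hj.symm y hy, TensorProduct.tmul_zero]
    · rw [hp0 _ _ hi.symm x hx, TensorProduct.zero_tmul]
  refine iSupIndep_iff_exists_projection.2 fun n => ⟨T n, fun t ht => ?_, fun m hm t ht => ?_⟩
  · rw [← sub_eq_zero, ← Submodule.mem_bot k]
    refine map_mem_of_mem_tensorGrading (T n - LinearMap.id) (fun i j hij x hx y hy => ?_) ht
    have hT : T n (x ⊗ₜ y) = x ⊗ₜ y := by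
      rw [LinearMap.sum_apply, Finset.sum_eq_single_of_mem (i, j)
        (Finset.HasAntidiagonal.mem_antidiagonal.2 hij) fun r _ hr => hpq hx hy hr,
        TensorProduct.map_tmul, hp i x hx, hq j y hy]
    simp [hT]
  · rw [← Submodule.mem_bot k]
    refine map_mem_of_mem_tensorGrading (T n) (fun i j hij x hx y hy => ?_) ht
    rw [Submodule.mem_bot, LinearMap.sum_apply]
    refine Finset.sum_eq_zero fun r hr => hpq hx hy ?_
    rintro rfl
    exact hm (hij.symm.trans (Finset.HasAntidiagonal.mem_antidiagonal.1 hr))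

theorem IsGradedMap.eq_zero_of_mem_iSup {𝒰 : ℕ → Submodule k M} {𝒱 : ℕ → Submodule k N}
    {f : M →ₗ[k] N} (hf : IsGradedMap 𝒰 𝒱 f) (h𝒱 : iSupIndep 𝒱) {n : ℕ} {x : M} (hx : x ∈ 𝒰 n)
    (hx' : x ∈ ⨆ m, ⨆ _ : m ≠ n, 𝒰 m) : f x = 0 := by
  have hle : ⨆ m, ⨆ _ : m ≠ n, 𝒰 m ≤ (⨆ m, ⨆ _ : m ≠ n, 𝒱 m).comap f :=
    iSup₂_le fun m hm _ hx => Submodule.mem_iSup_of_mem m (Submodule.mem_iSup_of_mem hm (hf hx))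
  exact Submodule.disjoint_def.1 (h𝒱 n) _ (hf hx) (hle hx')

end Independence

section GeneratedGrading

variable {σ R B : Type*} [AddMonoid σ] [CommSemiring R] [Semiring B] [Algebra R B]

/-- The smallest family `𝒢` of submodules of the algebra `B` with `1 ∈ 𝒢 0` and
`𝒢 i * 𝒢 j ⊆ 𝒢 (i + j)` which contains the family `𝒮`. It need not be a direct sum decomposition
of `B`. -/
def generatedGrading (𝒮 : σ → Submodule R B) : σ → Submodule R B :=
  sInf {𝒢 | SetLike.GradedMonoid 𝒢 ∧ 𝒮 ≤ 𝒢}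

variable {𝒮 : σ → Submodule R B}

theorem mem_generatedGrading {n : σ} {x : B} :
    x ∈ generatedGrading 𝒮 n ↔
      ∀ 𝒢 : σ → Submodule R B, SetLike.GradedMonoid 𝒢 → 𝒮 ≤ 𝒢 → x ∈ 𝒢 n := by
  simp [generatedGrading, sInf_apply, Submodule.mem_iInf]

theorem le_generatedGrading : 𝒮 ≤ generatedGrading 𝒮 := le_sInf fun _ h𝒢 => h𝒢.2

theorem generatedGrading_le {𝒢 : σ → Submodule R B} [h : SetLike.GradedMonoid 𝒢] (h𝒢 : 𝒮 ≤ 𝒢) :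
    generatedGrading 𝒮 ≤ 𝒢 := sInf_le ⟨h, h𝒢⟩

instance generatedGrading.gradedMonoid : SetLike.GradedMonoid (generatedGrading 𝒮) where
  one_mem := mem_generatedGrading.2 fun _ h _ => h.one_mem
  mul_mem _ _ _ _ hx hy := mem_generatedGrading.2 fun 𝒢 h h𝒢 =>
    h.mul_mem (mem_generatedGrading.1 hx 𝒢 h h𝒢) (mem_generatedGrading.1 hy 𝒢 h h𝒢)

theorem iSup_generatedGrading_eq_top (h𝒮 : Algebra.adjoin R (⋃ n, (𝒮 n : Set B)) = ⊤) :
    ⨆ n, generatedGrading 𝒮 n = ⊤ := by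
  classical
  rw [Submodule.iSup_eq_toSubmodule_range, eq_top_iff, ← Algebra.top_toSubmodule, ← h𝒮]
  refine Algebra.adjoin_le (Set.iUnion_subset fun n x hx => ?_)
  exact ⟨DirectSum.of (fun n => generatedGrading 𝒮 n) n ⟨x, le_generatedGrading n hx⟩,
    DirectSum.coeAlgHom_of ..⟩

theorem generatedGrading_le_ker {S : Type*} [Semiring S] [Algebra R S] {𝒮 : ℕ → Submodule R B}
    (ε : B →ₐ[R] S) (h𝒮 : ∀ n, n ≠ 0 → 𝒮 n ≤ LinearMap.ker ε.toLinearMap) {n : ℕ} (hn : n ≠ 0) :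
    generatedGrading 𝒮 n ≤ LinearMap.ker ε.toLinearMap := by
  let 𝒢 (n : ℕ) : Submodule R B := ⨅ _ : n ≠ 0, LinearMap.ker ε.toLinearMap
  have mem_𝒢 {n : ℕ} {x : B} : x ∈ 𝒢 n ↔ (n ≠ 0 → ε x = 0) := by simp [𝒢, Submodule.mem_iInf]
  have : SetLike.GradedMonoid 𝒢 :=
    { one_mem := mem_𝒢.2 (absurd rfl)
      mul_mem := fun i j x y hx hy => mem_𝒢.2 fun hij => by
        rw [map_mul]
        rcases (by omega : i ≠ 0 ∨ j ≠ 0) with hi | hj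
        · rw [mem_𝒢.1 hx hi, zero_mul]
        · rw [mem_𝒢.1 hy hj, mul_zero] }
  exact fun x hx => mem_𝒢.1
    (generatedGrading_le (𝒢 := 𝒢) (fun n _ hx => mem_𝒢.2 fun hn => h𝒮 n hn hx) n hx) hn

end GeneratedGrading

section LowDegrees

variable {R B : Type*} [CommSemiring R] [Semiring B] [Algebra R B] {𝒮 : ℕ → Submodule R B}

/-- The family `R1, 𝒮 1, B, B, …`, an upper bound for the family generated by `𝒮` which is sharp in
degrees `0` and `1`. -/
def lowDegreeFamily (𝒮 : ℕ → Submodule R B) : ℕ → Submodule R B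
  | 0 => Submodule.span R {1}
  | 1 => 𝒮 1
  | _ + 2 => ⊤

instance lowDegreeFamily.gradedMonoid : SetLike.GradedMonoid (lowDegreeFamily 𝒮) where
  one_mem := Submodule.mem_span_singleton_self 1
  mul_mem i j x y hx hy := by
    match i, j with
    | 0, j =>
      obtain ⟨c, rfl⟩ := Submodule.mem_span_singleton.1 hx
      simpa using Submodule.smul_mem _ c hy
    | i + 1, 0 =>
      obtain ⟨c, rfl⟩ := Submodule.mem_span_singleton.1 hy
      simpa using Submodule.smul_mem _ c hx
    | i + 1, j + 1 =>
      rw [show i + 1 + (j + 1) = i + j + 2 by omega]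
      exact Submodule.mem_top

theorem generatedGrading_le_lowDegreeFamily (h0 : 𝒮 0 = ⊥) :
    generatedGrading 𝒮 ≤ lowDegreeFamily 𝒮 :=
  generatedGrading_le fun
    | 0 => h0.trans_le bot_le
    | 1 => le_rfl
    | _ + 2 => le_top

theorem generatedGrading_zero (h0 : 𝒮 0 = ⊥) : generatedGrading 𝒮 0 = Submodule.span R {1} :=
  le_antisymm (generatedGrading_le_lowDegreeFamily h0 0) <|
    (Submodule.span_singleton_le_iff_mem _ _).2 SetLike.GradedOne.one_mem

theorem generatedGrading_one (h0 : 𝒮 0 = ⊥) : generatedGrading 𝒮 1 = 𝒮 1 :=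
  le_antisymm (generatedGrading_le_lowDegreeFamily h0 1) (le_generatedGrading 1)

end LowDegrees

section Truncation

variable {k M : Type*} [Field k] [AddCommGroup M] [Module k M] {𝒰 : ℕ → Submodule k M}

/-- The members of a family in degrees less than `N`. -/
def truncation (𝒰 : ℕ → Submodule k M) (N n : ℕ) : Submodule k M :=
  if n < N then 𝒰 n else ⊥

theorem truncation_of_lt {n N : ℕ} (h : n < N) : truncation 𝒰 N n = 𝒰 n := if_pos h

theorem truncation_of_le {n N : ℕ} (h : N ≤ n) : truncation 𝒰 N n = ⊥ := if_neg h.not_gt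

theorem truncation_le (N : ℕ) : truncation 𝒰 N ≤ 𝒰 := fun n => by
  unfold truncation
  split_ifs
  exacts [le_rfl, bot_le]

theorem iSupIndep_of_truncation (h : ∀ N, iSupIndep (truncation 𝒰 N)) : iSupIndep 𝒰 :=
  iSupIndep_iff_supIndep.2 fun s => ((h (s.sup id + 1)).supIndep' s).mono fun _ hn =>
    (truncation_of_lt (Nat.lt_succ_of_le (Finset.le_sup (f := id) hn))).ge

theorem IsGradedMap.of_truncation {P : Type*} [AddCommGroup P] [Module k P]
    {𝒱 : ℕ → Submodule k P} {f : M →ₗ[k] P} {N : ℕ}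
    (h : ∀ ⦃n⦄, n < N → ∀ ⦃x⦄, x ∈ 𝒰 n → f x ∈ 𝒱 n) : IsGradedMap (truncation 𝒰 N) 𝒱 f := by
  intro n x hx
  rcases lt_or_ge n N with hn | hn
  · exact h hn (truncation_of_lt (𝒰 := 𝒰) hn ▸ hx)
  · rw [truncation_of_le hn, Submodule.mem_bot] at hx
    simp [hx]

end Truncation

section ReducedComul

variable {R C : Type*} [CommRing R] [AddCommGroup C] [Module R C] [Coalgebra R C]

/-- The endomorphism `x ↦ x - ε(x) e` of a coalgebra. If `ε(e) = 1` it is the projection onto the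
kernel of the counit along `e`. -/
def projKerCounit (R : Type*) {C : Type*} [CommRing R] [AddCommGroup C] [Module R C]
    [Coalgebra R C] (e : C) : C →ₗ[R] C :=
  LinearMap.id - (Coalgebra.counit (R := R)).smulRight e

theorem projKerCounit_apply (e x : C) :
    projKerCounit R e x = x - Coalgebra.counit (R := R) x • e := rfl

/-- The reduced comultiplication with respect to a group-like element `e`. On the kernel of the
counit it is given by the usual formula `x ↦ Δ(x) - (x ⊗ e + e ⊗ x)`. -/
def reducedComul (R : Type*) {C : Type*} [CommRing R] [AddCommGroup C] [Module R C]
    [Coalgebra R C] (e : C) : C →ₗ[R] C ⊗[R] C :=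
  TensorProduct.map (projKerCounit R e) (projKerCounit R e) ∘ₗ Coalgebra.comul

theorem lTensor_projKerCounit_comul (e x : C) :
    (projKerCounit R e).lTensor C (Coalgebra.comul x) = Coalgebra.comul x - x ⊗ₜ e := by
  have h : (Coalgebra.counit (R := R) (A := C)).smulRight e =
    LinearMap.toSpanSingleton R C e ∘ₗ Coalgebra.counit := rfl
  simp [projKerCounit, LinearMap.lTensor_sub, h, LinearMap.lTensor_comp_apply]

theorem rTensor_projKerCounit_comul (e x : C) :
    (projKerCounit R e).rTensor C (Coalgebra.comul x) = Coalgebra.comul x - e ⊗ₜ x := by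
  have h : (Coalgebra.counit (R := R) (A := C)).smulRight e =
    LinearMap.toSpanSingleton R C e ∘ₗ Coalgebra.counit := rfl
  simp [projKerCounit, LinearMap.rTensor_sub, h, LinearMap.rTensor_comp_apply]

theorem reducedComul_eq_of_counit_eq_zero (e : C) {x : C} (hx : Coalgebra.counit (R := R) x = 0) :
    reducedComul R e x = Coalgebra.comul (R := R) x - (x ⊗ₜ e + e ⊗ₜ x) := by
  rw [reducedComul, LinearMap.comp_apply, ← LinearMap.rTensor_comp_lTensor, LinearMap.comp_apply,
    lTensor_projKerCounit_comul, map_sub, rTensor_projKerCounit_comul, LinearMap.rTensor_tmul,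
    projKerCounit_apply, hx, zero_smul, sub_zero, sub_sub, add_comm]

end ReducedComul

section Connected

variable {k C N : Type*} [Field k] [AddCommGroup C] [Module k C] [Coalgebra k C]

/-- A family of submodules of a coalgebra which behaves like a connected grading with group-like
element `e`, except that it need not be a direct sum decomposition. -/
structure IsConnectedCoalgFamily (e : C) (𝒢 : ℕ → Submodule k C) : Prop where
  isGroupLikeElem : IsGroupLikeElem k e
  zero_eq : 𝒢 0 = Submodule.span k {e}
  comul_mem : IsGradedMap 𝒢 (tensorGrading 𝒢 𝒢) (Coalgebra.comul (R := k))
  counit_eq_zero : ∀ ⦃n : ℕ⦄ ⦃x : C⦄, n ≠ 0 → x ∈ 𝒢 n → Coalgebra.counit (R := k) x = 0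

namespace IsConnectedCoalgFamily

variable {e : C} {𝒢 : ℕ → Submodule k C} (h𝒢 : IsConnectedCoalgFamily e 𝒢)

include h𝒢

theorem projKerCounit_eq_self {n : ℕ} (hn : n ≠ 0) {x : C} (hx : x ∈ 𝒢 n) :
    projKerCounit k e x = x := by
  rw [projKerCounit_apply, h𝒢.counit_eq_zero hn hx, zero_smul, sub_zero]

theorem projKerCounit_eq_zero {x : C} (hx : x ∈ 𝒢 0) : projKerCounit k e x = 0 := by
  rw [h𝒢.zero_eq, Submodule.mem_span_singleton] at hx
  obtain ⟨c, rfl⟩ := hx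
  simp [projKerCounit_apply, h𝒢.isGroupLikeElem]

theorem reducedComul_mem {n : ℕ} {x : C} (hx : x ∈ 𝒢 n) {N : ℕ} (hN : n ≤ N) :
    reducedComul k e x ∈ tensorGrading (truncation 𝒢 N) (truncation 𝒢 N) n := by
  refine map_mem_of_mem_tensorGrading (TensorProduct.map (projKerCounit k e) (projKerCounit k e))
    (fun i j hij y hy z hz => ?_) (h𝒢.comul_mem hx)
  rw [TensorProduct.map_tmul]
  rcases eq_or_ne i 0 with rfl | hi
  · simp [h𝒢.projKerCounit_eq_zero hy]
  rcases eq_or_ne j 0 with rfl | hj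
  · simp [h𝒢.projKerCounit_eq_zero hz]
  rw [h𝒢.projKerCounit_eq_self hi hy, h𝒢.projKerCounit_eq_self hj hz]
  apply tmul_mem_tensorGrading hij
  · rwa [truncation_of_lt (by omega)]
  · rwa [truncation_of_lt (by omega)]

theorem iSupIndep_truncation [AddCommGroup N] [Module k N] {𝒩 : ℕ → Submodule k N}
    (h𝒩 : iSupIndep 𝒩) {φ : C →ₗ[k] N} (hφ : IsGradedMap 𝒢 𝒩 φ)
    (hprim : ∀ x, Coalgebra.comul (R := k) x = x ⊗ₜ e + e ⊗ₜ x → φ x = 0 → x = 0) (L : ℕ) :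
    iSupIndep (truncation 𝒢 L) := by
  induction L with
  | zero => exact fun n => by simp [truncation_of_le]
  | succ L ih =>
    refine fun n => Submodule.disjoint_def.2 fun x hx hx' => ?_
    have hφx : φ x = 0 :=
      (IsGradedMap.of_truncation fun _ _ _ hx => hφ hx).eq_zero_of_mem_iSup h𝒩 hx hx'
    have hΔx : reducedComul k e x = 0 :=
      (IsGradedMap.of_truncation fun _ hn _ hx => h𝒢.reducedComul_mem hx (Nat.le_of_lt_succ hn))
        |>.eq_zero_of_mem_iSup (iSupIndep_tensorGrading ih ih) hx hx'
    have hεx : Coalgebra.counit (R := k) x = 0 := by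
      have hε (m : ℕ) (hm : m ≠ 0) :
          truncation 𝒢 (L + 1) m ≤ LinearMap.ker (Coalgebra.counit (R := k)) :=
        fun _ hy => h𝒢.counit_eq_zero hm (truncation_le (L + 1) m hy)
      rcases eq_or_ne n 0 with rfl | hn
      exacts [iSup₂_le hε hx', hε n hn hx]
    rw [reducedComul_eq_of_counit_eq_zero e hεx, sub_eq_zero] at hΔx
    exact hprim x hΔx hφx

theorem iSupIndep_of_isGradedMap [AddCommGroup N] [Module k N] {𝒩 : ℕ → Submodule k N}
    (h𝒩 : iSupIndep 𝒩) {φ : C →ₗ[k] N} (hφ : IsGradedMap 𝒢 𝒩 φ)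
    (hprim : ∀ x, Coalgebra.comul (R := k) x = x ⊗ₜ e + e ⊗ₜ x → φ x = 0 → x = 0) :
    iSupIndep 𝒢 :=
  iSupIndep_of_truncation (h𝒢.iSupIndep_truncation h𝒩 hφ hprim)

theorem isGradedMap_of_convolution_inverse {R : Type*} [Ring R] [Algebra k R]
    {ℛ : ℕ → Submodule k R} [SetLike.GradedMonoid ℛ] {f g : C →ₗ[k] R}
    (hg : IsGradedMap 𝒢 ℛ g) (hge : g e = 1)
    (hfg : LinearMap.mul' k R ∘ₗ TensorProduct.map f g ∘ₗ Coalgebra.comul =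
      Algebra.linearMap k R ∘ₗ Coalgebra.counit) : IsGradedMap 𝒢 ℛ f := by
  have hfgx (x : C) : LinearMap.mul' k R (TensorProduct.map f g (Coalgebra.comul x)) =
      algebraMap k R (Coalgebra.counit x) := LinearMap.congr_fun hfg x
  have hfe : f e = 1 := by simpa [h𝒢.isGroupLikeElem, hge] using hfgx e
  intro n
  induction n using Nat.strong_induction_on with
  | _ n ih =>
    intro x hx
    rcases eq_or_ne n 0 with rfl | hn
    · rw [h𝒢.zero_eq, Submodule.mem_span_singleton] at hx
      obtain ⟨c, rfl⟩ := hx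
      rw [map_smul, hfe]
      exact Submodule.smul_mem _ c SetLike.GradedOne.one_mem
    · have hεx := h𝒢.counit_eq_zero hn hx
      have hred : LinearMap.mul' k R (TensorProduct.map f g (reducedComul k e x)) =
          -(f x + g x) := by
        simp [reducedComul_eq_of_counit_eq_zero e hεx, hfgx, hεx, hfe, hge]
      have hmem : LinearMap.mul' k R (TensorProduct.map f g (reducedComul k e x)) ∈ ℛ n :=
        IsGradedMap.mul' <| IsGradedMap.map (IsGradedMap.of_truncation ih)
          (IsGradedMap.of_truncation fun _ _ _ hx => hg hx) (h𝒢.reducedComul_mem hx le_rfl)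
      rw [hred, neg_mem_iff] at hmem
      exact (Submodule.add_mem_iff_left _ (hg hx)).1 hmem

end IsConnectedCoalgFamily

end Connected

section Braiding

variable {k A M N B : Type*} [Field k] [Ring A] [HopfAlgebra k A] [AddCommGroup M] [Module k M]
  [Module A M] [IsScalarTower k A M] [AddCommGroup N] [Module k N] [Module A N]
  [IsScalarTower k A N] [Ring B] [Algebra k B] [Module A B] [IsScalarTower k A B]

theorem tensorAct_tmul (a : A) (x : M) (y : N) :
    tensorAct k A M N a (x ⊗ₜ y) =
      TensorProduct.map ((LinearMap.toSpanSingleton A M x).restrictScalars k)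
        ((LinearMap.toSpanSingleton A N y).restrictScalars k) (Coalgebra.comul a) := by
  simp only [tensorAct, LinearMap.comp_apply]
  induction Coalgebra.comul (R := k) a with
  | zero => simp
  | tmul b c => simp
  | add s t hs ht => simp [hs, ht]

variable [YetterDrinfeldModule k A M] [YetterDrinfeldModule k A B] {𝒜 : ℕ → Submodule k A}

theorem IsGradedMap.braiding {𝒰 : ℕ → Submodule k M} {𝒱 : ℕ → Submodule k N}
    (hcoact : IsGradedMap 𝒰 (tensorGrading 𝒜 𝒰) (coact (k := k) (A := A) (M := M)))
    (hact : IsGradedMap (tensorGrading 𝒜 𝒱) 𝒱 (act k A N)) :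
    IsGradedMap (tensorGrading 𝒰 𝒱) (tensorGrading 𝒱 𝒰) (braiding k A M N) :=
  (hact.map .id).comp (rightComm.comp (hcoact.map .id))

theorem IsGradedMap.braidedMul {𝒢 : ℕ → Submodule k B} [SetLike.GradedMonoid 𝒢]
    (hcoact : IsGradedMap 𝒢 (tensorGrading 𝒜 𝒢) (coact (k := k) (A := A) (M := B)))
    (hact : IsGradedMap (tensorGrading 𝒜 𝒢) 𝒢 (act k A B)) :
    IsGradedMap (tensorGrading (tensorGrading 𝒢 𝒢) (tensorGrading 𝒢 𝒢)) (tensorGrading 𝒢 𝒢)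
      (braidedMul k A B) :=
  (IsGradedMap.map .mul' .mul').comp <| assoc_symm.comp <|
    (IsGradedMap.map .id (assoc.comp (((hcoact.braiding hact).map .id).comp assoc_symm))).comp assoc

end Braiding

section BraidedHopfAlgebra

theorem IsAlgCoalgGrading.gradedMonoid {k R : Type*} [Field k] [Ring R] [Algebra k R]
    [Coalgebra k R] {ℛ : ℕ → Submodule k R} (hℛ : IsAlgCoalgGrading ℛ) :
    SetLike.GradedMonoid ℛ where
  one_mem := hℛ.one_mem
  mul_mem _ _ _ _ := hℛ.mul_mem

variable {k A B : Type*} [Field k] [Ring A] [HopfAlgebra k A] [Ring B] [Algebra k B]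
  [Coalgebra k B] [Module A B] [IsScalarTower k A B] [YetterDrinfeldModule k A B]
  [BraidedHopfAlgebra k A B] {𝒜 : ℕ → Submodule k A} {𝒮 : ℕ → Submodule k B}

variable (k A B) in
/-- The counit of a braided Hopf algebra as a morphism of algebras. -/
def counitAlgHom : B →ₐ[k] k :=
  AlgHom.ofLinearMap Coalgebra.counit (BraidedHopfAlgebra.counit_one (A := A))
    (BraidedHopfAlgebra.counit_mul (A := A))

variable (k A B) in
include A in
theorem isGroupLikeElem_one : IsGroupLikeElem k (1 : B) where
  counit_eq_one := BraidedHopfAlgebra.counit_one (A := A)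
  comul_eq_tmul_self := BraidedHopfAlgebra.comul_one (A := A)

theorem isGradedMap_act_generatedGrading (h𝒜 : IsAlgCoalgGrading 𝒜)
    (h𝒮 : IsGradedMap (tensorGrading 𝒜 𝒮) 𝒮 (act k A B)) :
    IsGradedMap (tensorGrading 𝒜 (generatedGrading 𝒮)) (generatedGrading 𝒮) (act k A B) := by
  let 𝒢 (n : ℕ) : Submodule k B :=
    ⨅ (i : ℕ) (a : 𝒜 i), (generatedGrading 𝒮 (i + n)).comap (Algebra.lsmul k k B (a : A))
  have mem_𝒢 {n : ℕ} {x : B} : x ∈ 𝒢 n ↔ IsGradedMap 𝒜 (fun i => generatedGrading 𝒮 (i + n))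
      ((LinearMap.toSpanSingleton A B x).restrictScalars k) := by
    simp [𝒢, Submodule.mem_iInf, IsGradedMap]
  have : SetLike.GradedMonoid 𝒢 :=
    { one_mem := mem_𝒢.2 fun i a ha => by
        rw [LinearMap.restrictScalars_apply, LinearMap.toSpanSingleton_apply,
          BraidedHopfAlgebra.smul_one (k := k)]
        rcases eq_or_ne i 0 with rfl | hi
        · simpa using SetLike.algebraMap_mem_graded (generatedGrading 𝒮) _
        · simp [h𝒜.counit_eq_zero hi ha]
      mul_mem := fun p q x y hx hy => mem_𝒢.2 fun i a ha => by
        rw [LinearMap.restrictScalars_apply, LinearMap.toSpanSingleton_apply,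
          BraidedHopfAlgebra.smul_mul (k := k), tensorAct_tmul]
        refine IsGradedMap.of_tmul (𝒲 := fun i => generatedGrading 𝒮 (i + (p + q)))
          (fun r z hz s w hw => ?_) (((mem_𝒢.1 hx).map (mem_𝒢.1 hy)) (h𝒜.comul_mem ha))
        exact add_add_add_comm r p s q ▸ SetLike.GradedMul.mul_mem hz hw }
  have hle : generatedGrading 𝒮 ≤ 𝒢 := generatedGrading_le fun n x hx => mem_𝒢.2 fun i a ha =>
    le_generatedGrading _ (h𝒮 (tmul_mem_tensorGrading rfl ha hx))
  exact .of_tmul fun i a ha j x hx => mem_𝒢.1 (hle j hx) ha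

theorem isGradedMap_coact_generatedGrading [SetLike.GradedMonoid 𝒜]
    (h𝒮 : IsGradedMap 𝒮 (tensorGrading 𝒜 𝒮) (coact (k := k) (A := A) (M := B))) :
    IsGradedMap (generatedGrading 𝒮) (tensorGrading 𝒜 (generatedGrading 𝒮))
      (coact (k := k) (A := A) (M := B)) := by
  let 𝒢 (n : ℕ) : Submodule k B := (tensorGrading 𝒜 (generatedGrading 𝒮) n).comap coact
  have : SetLike.GradedMonoid 𝒢 :=
    { one_mem := by
        rw [Submodule.mem_comap, BraidedHopfAlgebra.coact_one]
        exact tmul_mem_tensorGrading (add_zero 0) SetLike.GradedOne.one_mem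
          SetLike.GradedOne.one_mem
      mul_mem := fun i j x y hx hy => by
        rw [Submodule.mem_comap, BraidedHopfAlgebra.coact_mul]
        exact ((IsGradedMap.map .id .mul').comp
          ((IsGradedMap.map .mul' .id).comp .tensorTensorTensorComm))
          (tmul_mem_tensorGrading rfl hx hy) }
  have hid : IsGradedMap 𝒮 (generatedGrading 𝒮) LinearMap.id := fun n _ hx =>
    le_generatedGrading n hx
  exact generatedGrading_le (𝒢 := 𝒢) fun n x hx => by
    simpa [𝒢] using (IsGradedMap.id (𝒰 := 𝒜)).map hid (h𝒮 hx)

theorem isGradedMap_comul_generatedGrading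
    (hcoact : IsGradedMap (generatedGrading 𝒮) (tensorGrading 𝒜 (generatedGrading 𝒮))
      (coact (k := k) (A := A) (M := B)))
    (hact : IsGradedMap (tensorGrading 𝒜 (generatedGrading 𝒮)) (generatedGrading 𝒮) (act k A B))
    (h𝒮 : IsGradedMap 𝒮 (tensorGrading (generatedGrading 𝒮) (generatedGrading 𝒮))
      (Coalgebra.comul (R := k))) :
    IsGradedMap (generatedGrading 𝒮)
      (tensorGrading (generatedGrading 𝒮) (generatedGrading 𝒮)) (Coalgebra.comul (R := k)) := by
  let 𝒢 (n : ℕ) : Submodule k B :=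
    (tensorGrading (generatedGrading 𝒮) (generatedGrading 𝒮) n).comap Coalgebra.comul
  have : SetLike.GradedMonoid 𝒢 :=
    { one_mem := by
        rw [Submodule.mem_comap, BraidedHopfAlgebra.comul_one (A := A)]
        exact tmul_mem_tensorGrading (add_zero 0) SetLike.GradedOne.one_mem
          SetLike.GradedOne.one_mem
      mul_mem := fun i j x y hx hy => by
        rw [Submodule.mem_comap, BraidedHopfAlgebra.comul_mul (A := A)]
        exact hcoact.braidedMul hact (tmul_mem_tensorGrading rfl hx hy) }
  exact generatedGrading_le (𝒢 := 𝒢) h𝒮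

theorem IsConnectedCoalgFamily.antipode_mem {𝒢 : ℕ → Submodule k B} [SetLike.GradedMonoid 𝒢]
    (h𝒢 : IsConnectedCoalgFamily 1 𝒢) :
    IsGradedMap 𝒢 𝒢 (BraidedHopfAlgebra.antipode (k := k) (A := A) (R := B)) :=
  h𝒢.isGradedMap_of_convolution_inverse .id rfl BraidedHopfAlgebra.antipode_left

end BraidedHopfAlgebra

section PointDerivation

variable {R B : Type*} [CommRing R] [Ring B] [Algebra R B]

theorem gradedAlgebra_proj_zero (ℛ : ℕ → Submodule R B) [GradedAlgebra ℛ] {ε : B →ₐ[R] R}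
    (hε : ∀ x ∈ ℛ 1, ε x = 0) (hℛ : Algebra.adjoin R (ℛ 1 : Set B) = ⊤) (x : B) :
    GradedAlgebra.proj ℛ 0 x = algebraMap R B (ε x) := by
  let proj₀ : B →ₐ[R] B :=
    { GradedRing.projZeroRingHom ℛ with
      commutes' := fun r => DirectSum.decompose_of_mem_same ℛ (SetLike.algebraMap_mem_graded ℛ r) }
  have h : proj₀ = (Algebra.ofId R B).comp ε := AlgHom.ext_of_adjoin_eq_top hℛ fun y hy => by
    have hy₀ : proj₀ y = 0 := DirectSum.decompose_of_mem_ne ℛ hy one_ne_zero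
    simp [hy₀, hε y hy]
  exact DFunLike.congr_fun h x

theorem gradedAlgebra_proj_one_mul (ℛ : ℕ → Submodule R B) [GradedAlgebra ℛ] {ε : B →ₐ[R] R}
    (hε : ∀ x ∈ ℛ 1, ε x = 0) (hℛ : Algebra.adjoin R (ℛ 1 : Set B) = ⊤) (x y : B) :
    GradedAlgebra.proj ℛ 1 (x * y) =
      ε x • GradedAlgebra.proj ℛ 1 y + ε y • GradedAlgebra.proj ℛ 1 x := by
  have h (z : B) : (DirectSum.decompose ℛ z 0 : B) = algebraMap R B (ε z) :=
    gradedAlgebra_proj_zero ℛ hε hℛ z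
  simp only [GradedAlgebra.proj_apply]
  rw [DirectSum.decompose_mul, DirectSum.coe_mul_apply_eq_sum_antidiagonal]
  simp [Finset.Nat.antidiagonal_succ, h, Algebra.smul_def, Algebra.commutes]

theorem isGradedMap_generatedGrading_of_pointDerivation {k B M : Type*} [Field k] [Ring B]
    [Algebra k B] [AddCommGroup M] [Module k M] {𝒮 : ℕ → Submodule k B} {𝒩 : ℕ → Submodule k M}
    {ε : B →ₐ[k] k} {φ : B →ₗ[k] M} (hφ : ∀ x y, φ (x * y) = ε x • φ y + ε y • φ x)
    (hε𝒮 : ∀ n, n ≠ 0 → 𝒮 n ≤ LinearMap.ker ε.toLinearMap) (hφ𝒮 : IsGradedMap 𝒮 𝒩 φ) :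
    IsGradedMap (generatedGrading 𝒮) 𝒩 φ := by
  have hφ_one : φ 1 = 0 := by simpa using hφ 1 1
  let 𝒢 (n : ℕ) : Submodule k B := generatedGrading 𝒮 n ⊓ (𝒩 n).comap φ
  have smul_mem {i j : ℕ} {x y : B} (hx : x ∈ 𝒢 i) (hy : y ∈ 𝒢 j) : ε x • φ y ∈ 𝒩 (i + j) := by
    rcases eq_or_ne i 0 with rfl | hi
    · simpa using Submodule.smul_mem _ (ε x) hy.2
    · have hεx : ε x = 0 := generatedGrading_le_ker ε hε𝒮 hi hx.1
      simp [hεx]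
  have : SetLike.GradedMonoid 𝒢 :=
    { one_mem := ⟨SetLike.GradedOne.one_mem, by simp [hφ_one]⟩
      mul_mem := fun i j x y hx hy => ⟨SetLike.GradedMul.mul_mem hx.1 hy.1, by
        rw [SetLike.mem_coe, Submodule.mem_comap, hφ]
        exact add_mem (smul_mem hx hy) (add_comm j i ▸ smul_mem hy hx)⟩ }
  exact fun n x hx =>
    (generatedGrading_le (𝒢 := 𝒢) (fun n x hx => ⟨le_generatedGrading n hx, hφ𝒮 hx⟩) n hx).2

end PointDerivation

section NicholsAlgebra

variable {k A M B : Type*} [Field k] [Ring A] [HopfAlgebra k A] [AddCommGroup M] [Module k M]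
  [Module A M] [IsScalarTower k A M] [YetterDrinfeldModule k A M] [Ring B] [Algebra k B]
  [Coalgebra k B] [Module A B] [IsScalarTower k A B] [YetterDrinfeldModule k A B]
  [BraidedHopfAlgebra k A B] {ι : M →ₗ[k] B} {𝒜 : ℕ → Submodule k A} {ℳ : ℕ → Submodule k M}

namespace IsNicholsAlgebra

theorem mem_range_iff (hι : IsNicholsAlgebra A ι) {x : B} :
    x ∈ LinearMap.range ι ↔ Coalgebra.comul (R := k) x = x ⊗ₜ 1 + 1 ⊗ₜ x := by
  obtain ⟨ℛ, -, -, hrange, -, hprim⟩ := hι.exists_grading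
  rw [hrange, hprim]

theorem adjoin_range (hι : IsNicholsAlgebra A ι) :
    Algebra.adjoin k (LinearMap.range ι : Set B) = ⊤ := by
  obtain ⟨ℛ, -, -, hrange, hgen, -⟩ := hι.exists_grading
  rw [hrange, hgen]

theorem range_le_ker_counit (hι : IsNicholsAlgebra A ι) :
    LinearMap.range ι ≤ LinearMap.ker (counitAlgHom k A B).toLinearMap := by
  obtain ⟨ℛ, hℛ, -, hrange, -⟩ := hι.exists_grading
  exact fun _ hx => hℛ.counit_eq_zero one_ne_zero (hrange ▸ hx)

theorem exists_pointDerivation_leftInverse (hι : IsNicholsAlgebra A ι) :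
    ∃ φ : B →ₗ[k] M, φ ∘ₗ ι = LinearMap.id ∧
      ∀ x y, φ (x * y) = counitAlgHom k A B x • φ y + counitAlgHom k A B y • φ x := by
  obtain ⟨ℛ, hℛ, -, hrange, hgen, -⟩ := hι.exists_grading
  have := hℛ.gradedMonoid
  let : DirectSum.Decomposition ℛ := hℛ.isInternal.chooseDecomposition
  let : GradedAlgebra ℛ := {}
  obtain ⟨p, hp⟩ := ι.exists_leftInverse_of_injective (LinearMap.ker_eq_bot.2 hι.ι_injective)
  refine ⟨p ∘ₗ GradedAlgebra.proj ℛ 1, LinearMap.ext fun m => ?_, fun x y => ?_⟩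
  · have hm : ι m ∈ ℛ 1 := hrange ▸ LinearMap.mem_range_self ι m
    simpa [GradedAlgebra.proj_apply, DirectSum.decompose_of_mem_same ℛ hm] using
      LinearMap.congr_fun hp m
  · have hε (z : B) (hz : z ∈ ℛ 1) : counitAlgHom k A B z = 0 := hℛ.counit_eq_zero one_ne_zero hz
    simp only [LinearMap.comp_apply, gradedAlgebra_proj_one_mul ℛ hε hgen, map_add, map_smul]

end IsNicholsAlgebra

/-- The family of subspaces of `B` generated by the images of the members of the family `ℳ`. When
`B` is a Nichols algebra of `M` and `ℳ` is a grading of `M`, this is the grading of `B` which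
extends `ℳ`. -/
abbrev inducedGrading {R M B : Type*} [CommSemiring R] [AddCommMonoid M] [Module R M] [Semiring B]
    [Algebra R B] (ι : M →ₗ[R] B) (ℳ : ℕ → Submodule R M) : ℕ → Submodule R B :=
  generatedGrading fun n => (ℳ n).map ι

namespace IsNicholsAlgebra

theorem iSup_inducedGrading (hι : IsNicholsAlgebra A ι) (hℳ : ⨆ n, ℳ n = ⊤) :
    ⨆ n, inducedGrading ι ℳ n = ⊤ := by
  refine iSup_generatedGrading_eq_top (eq_top_iff.2 ?_)
  rw [← hι.adjoin_range, LinearMap.range_eq_map, ← hℳ, Submodule.map_iSup]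
  refine Algebra.adjoin_le fun x hx => ?_
  have h : ⨆ n, (ℳ n).map ι ≤
      (Algebra.adjoin k (⋃ n, ((ℳ n).map ι : Set B))).toSubmodule :=
    iSup_le fun n y hy => Algebra.subset_adjoin (Set.mem_iUnion_of_mem n hy)
  exact h hx

theorem isGradedMap_act (hι : IsNicholsAlgebra A ι) (h𝒜 : IsAlgCoalgGrading 𝒜)
    (hℳ : IsYDGrading 𝒜 ℳ) :
    IsGradedMap (tensorGrading 𝒜 (inducedGrading ι ℳ)) (inducedGrading ι ℳ) (act k A B) :=
  isGradedMap_act_generatedGrading h𝒜 <| .of_tmul fun i a ha j x hx => by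
    obtain ⟨m, hm, rfl⟩ := hx
    exact ⟨a • m, hℳ.smul_mem ha hm, hι.ι_smul a m⟩

theorem isGradedMap_coact (hι : IsNicholsAlgebra A ι) (h𝒜 : IsAlgCoalgGrading 𝒜)
    (hℳ : IsYDGrading 𝒜 ℳ) :
    IsGradedMap (inducedGrading ι ℳ) (tensorGrading 𝒜 (inducedGrading ι ℳ))
      (coact (k := k) (A := A) (M := B)) := by
  have := h𝒜.gradedMonoid
  refine isGradedMap_coact_generatedGrading ?_
  rintro n _ ⟨m, hm, rfl⟩
  have hmap : IsGradedMap ℳ (fun n => (ℳ n).map ι) ι := fun _ _ => Submodule.mem_map_of_mem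
  rw [hι.ι_coact]
  exact (IsGradedMap.id.map hmap) (hℳ.coact_mem hm)

theorem isConnectedCoalgFamily (hι : IsNicholsAlgebra A ι) (h𝒜 : IsAlgCoalgGrading 𝒜)
    (hℳ : IsYDGrading 𝒜 ℳ) (hℳ0 : ℳ 0 = ⊥) :
    IsConnectedCoalgFamily (1 : B) (inducedGrading ι ℳ) where
  isGroupLikeElem := isGroupLikeElem_one k A B
  zero_eq := generatedGrading_zero (by rw [hℳ0, Submodule.map_bot])
  comul_mem := isGradedMap_comul_generatedGrading (hι.isGradedMap_coact h𝒜 hℳ)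
    (hι.isGradedMap_act h𝒜 hℳ) fun n x hx => by
      rw [hι.mem_range_iff.1 (LinearMap.map_le_range hx)]
      have hx' : x ∈ inducedGrading ι ℳ n := le_generatedGrading n hx
      exact add_mem (tmul_mem_tensorGrading (add_zero n) hx' SetLike.GradedOne.one_mem)
        (tmul_mem_tensorGrading (zero_add n) SetLike.GradedOne.one_mem hx')
  counit_eq_zero _ _ hn hx := generatedGrading_le_ker (counitAlgHom k A B)
    (fun _ _ => LinearMap.map_le_range.trans hι.range_le_ker_counit) hn hx

theorem iSupIndep_inducedGrading (hι : IsNicholsAlgebra A ι) (h𝒜 : IsAlgCoalgGrading 𝒜)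
    (hℳ : IsYDGrading 𝒜 ℳ) (hℳ0 : ℳ 0 = ⊥) : iSupIndep (inducedGrading ι ℳ) := by
  obtain ⟨φ, hφι, hφ⟩ := hι.exists_pointDerivation_leftInverse
  have hφι' (m : M) : φ (ι m) = m := LinearMap.congr_fun hφι m
  have hφ_graded : IsGradedMap (inducedGrading ι ℳ) ℳ φ := by
    refine isGradedMap_generatedGrading_of_pointDerivation hφ 
      (fun n _ => LinearMap.map_le_range.trans hι.range_le_ker_counit) ?_
    rintro n _ ⟨m, hm, rfl⟩
    rwa [hφι']
  refine (hι.isConnectedCoalgFamily h𝒜 hℳ hℳ0).iSupIndep_of_isGradedMap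
    hℳ.isInternal.submodule_iSupIndep hφ_graded fun x hΔx hφx => ?_
  obtain ⟨m, rfl⟩ := hι.mem_range_iff.2 hΔx
  rw [← hφι' m, hφx, map_zero]

theorem isInternal_inducedGrading (hι : IsNicholsAlgebra A ι) (h𝒜 : IsAlgCoalgGrading 𝒜)
    (hℳ : IsYDGrading 𝒜 ℳ) (hℳ0 : ℳ 0 = ⊥) : DirectSum.IsInternal (inducedGrading ι ℳ) :=
  DirectSum.isInternal_submodule_of_iSupIndep_of_iSup_eq_top
    (hι.iSupIndep_inducedGrading h𝒜 hℳ hℳ0)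
    (hι.iSup_inducedGrading hℳ.isInternal.submodule_iSup_eq_top)

theorem isYDGrading_inducedGrading (hι : IsNicholsAlgebra A ι) (h𝒜 : IsAlgCoalgGrading 𝒜)
    (hℳ : IsYDGrading 𝒜 ℳ) (hℳ0 : ℳ 0 = ⊥) : IsYDGrading 𝒜 (inducedGrading ι ℳ) where
  isInternal := hι.isInternal_inducedGrading h𝒜 hℳ hℳ0
  smul_mem ha hx := hι.isGradedMap_act h𝒜 hℳ (tmul_mem_tensorGrading rfl ha hx)
  coact_mem hx := hι.isGradedMap_coact h𝒜 hℳ hx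

theorem isBraidedHopfGrading_inducedGrading (hι : IsNicholsAlgebra A ι)
    (h𝒜 : IsAlgCoalgGrading 𝒜) (hℳ : IsYDGrading 𝒜 ℳ) (hℳ0 : ℳ 0 = ⊥) :
    IsBraidedHopfGrading A (inducedGrading ι ℳ) where
  isInternal := hι.isInternal_inducedGrading h𝒜 hℳ hℳ0
  one_mem := SetLike.GradedOne.one_mem
  mul_mem hx hy := SetLike.GradedMul.mul_mem hx hy
  comul_mem hx := (hι.isConnectedCoalgFamily h𝒜 hℳ hℳ0).comul_mem hx
  counit_eq_zero hn hx := (hι.isConnectedCoalgFamily h𝒜 hℳ hℳ0).counit_eq_zero hn hx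
  antipode_mem hx := (hι.isConnectedCoalgFamily h𝒜 hℳ hℳ0).antipode_mem hx

end IsNicholsAlgebra

end NicholsAlgebra

end

end Nichols

theorem mainTheorem7_general {k A M B : Type*} [Field k]
    [Ring A] [HopfAlgebra k A]
    (𝒜 : ℕ → Submodule k A) (h𝒜 : Nichols.IsAlgCoalgGrading 𝒜)
    [AddCommGroup M] [Module k M] [Module A M] [IsScalarTower k A M]
    [Nichols.YetterDrinfeldModule k A M]
    (ℳ : ℕ → Submodule k M) (hℳ : Nichols.IsYDGrading 𝒜 ℳ) (hℳ0 : ℳ 0 = ⊥)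
    [Ring B] [Algebra k B] [Coalgebra k B] [Module A B] [IsScalarTower k A B]
    [Nichols.YetterDrinfeldModule k A B] [Nichols.BraidedHopfAlgebra k A B]
    (ι : M →ₗ[k] B) (hι : Nichols.IsNicholsAlgebra A ι) :
    ∃ ℬ : ℕ → Submodule k B,
      Nichols.IsYDGrading 𝒜 ℬ ∧
      Nichols.IsBraidedHopfGrading A ℬ ∧
      ℬ 0 = Submodule.span k {1} ∧
      ℬ 1 = (ℳ 1).map ι :=
  ⟨Nichols.inducedGrading ι ℳ, hι.isYDGrading_inducedGrading h𝒜 hℳ hℳ0,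
    hι.isBraidedHopfGrading_inducedGrading h𝒜 hℳ hℳ0,
    Nichols.generatedGrading_zero (by rw [hℳ0, Submodule.map_bot]),
    Nichols.generatedGrading_one (by rw [hℳ0, Submodule.map_bot])⟩

theorem mainTheorem7 {k A M B : Type*} [Field k]
    [Ring A] [HopfAlgebra k A]
    (hS : Function.Bijective (HopfAlgebra.antipode k : A →ₗ[k] A))
    (𝒜 : ℕ → Submodule k A) (h𝒜 : Nichols.IsHopfGrading 𝒜)
    [AddCommGroup M] [Module k M] [Module A M] [IsScalarTower k A M]
    [Nichols.YetterDrinfeldModule k A M]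
    (ℳ : ℕ → Submodule k M) (hℳ : Nichols.IsYDGrading 𝒜 ℳ) (hℳ0 : ℳ 0 = ⊥)
    [Ring B] [Algebra k B] [Coalgebra k B] [Module A B] [IsScalarTower k A B]
    [Nichols.YetterDrinfeldModule k A B] [Nichols.BraidedHopfAlgebra k A B]
    (ι : M →ₗ[k] B) (hι : Nichols.IsNicholsAlgebra A ι) :
    ∃ ℬ : ℕ → Submodule k B,
      Nichols.IsYDGrading 𝒜 ℬ ∧
      Nichols.IsBraidedHopfGrading A ℬ ∧
      ℬ 0 = Submodule.span k {1} ∧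
      ℬ 1 = (ℳ 1).map ι :=
  mainTheorem7_general 𝒜 h𝒜.toIsAlgCoalgGrading ℳ hℳ hℳ0 ι hι
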